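/- Let $k\le m$ be nonnegative integers. For $x>0$ define the kernel $U_{k,m}(x)$ as follows. If $k=m$, $$U_{k,k}(x)=\int_{(0,\infty)^k}\Bigl(\exp\Bigl(\frac{x}{u_1u_2\cdots u_k}\Bigr)+1\Bigr)^{-1}\prod_{j=1}^{k}\frac{du_j}{(e^{u_j}+1)\,u_j}$$ (so that $U_{0,0}(x)=(e^x+1)^{-1}$), and if $k<m$, $$U_{k,m}(x)=\int_{(0,\infty)^m}\ \prod_{j=1}^{k+1}(e^{u_j}+1)^{-1}\,\exp\Bigl(-\sum_{j=k+2}^{m}u_j\Bigr)\exp\Bigl(-\frac{x}{u_1u_2\cdots u_m}\Bigr)\frac{du_1\cdots du_m}{u_1u_2\cdots u_m}.$$ Then the Riemann hypothesis is true if and only if, for every $\delta$ with $\frac12<\delta<1$ and every bounded measurable function $f$ on $\mathbb{R}$ (real-valued or complex-valued; the equivalence holds for either choice) such that $$\int_{\mathbb{R}}e^{-\delta u}\,U_{k,m}\bigl(e^{x-u}\bigr)f(u)\,du=0\qquad\text{for all }x\in\mathbb{R},$$ the function $f$ is zero almost everywhere. -/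

import Mathlib

noncomputable section

/-- The kernel with equal parameters:
`U_k(x) = ∫_{ℝ₊^k} (exp(x / (u₁⋯u_k)) + 1)⁻¹ ∏_{j=1}^k (e^{u_j} + 1)⁻¹ du_j / u_j`.
For `k = 0` the domain is a single point of mass one and `U_0(x) = (e^x + 1)⁻¹`. -/
def diagKernel (k : ℕ) (x : ℝ) : ℝ :=
  ∫ u in Set.univ.pi (fun _ : Fin k => Set.Ioi (0 : ℝ)),
    (Real.exp (x / ∏ j, u j) + 1)⁻¹ * ∏ j, ((Real.exp (u j) + 1)⁻¹ / u j)

/-- The kernel for `k < m`: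
`U_{k,m}(x) = ∫_{ℝ₊^m} ∏_{j=1}^{k+1} (e^{u_j} + 1)⁻¹ exp(-∑_{j=k+2}^m u_j)
  exp(-x / (u₁⋯u_m)) du₁⋯du_m / (u₁⋯u_m)`.
The coordinate `u_{j+1}` is `u j` with `j : Fin m`, so `u_1, …, u_{k+1}` are those with `j ≤ k`. -/
def offDiagKernel (k m : ℕ) (x : ℝ) : ℝ :=
  ∫ u in Set.univ.pi (fun _ : Fin m => Set.Ioi (0 : ℝ)),
    (∏ j with j.val ≤ k, (Real.exp (u j) + 1)⁻¹) * Real.exp (-∑ j with k < j.val, u j) *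
      Real.exp (-(x / ∏ j, u j)) / ∏ j, u j

/-- The kernel `U_{k,m}(x)`, `x > 0`, for `k ≤ m`. -/
def kernelU (k m : ℕ) (x : ℝ) : ℝ :=
  if k = m then diagKernel k x else offDiagKernel k m x

end

/-! `U_{k,m}` is a multiplicative convolution of `k + 1` Fermi functions and `m - k` copies of `exp
(-x)`, so for `Re s > 0` its Mellin transform is the product of theirs (`mellin_kernelU`). That of
the Fermi function is `Γ(s) (1 - 2^(1-s)) ζ(s)`. Within `0 < Re s < 1` only `ζ` can vanish, so the
transform of the kernel has exactly the zeros of `ζ`.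

In logarithmic variables the equation has the integrable kernel `e^{-δu} U_{k,m}(e^{-u})`, whose
Fourier transform at `ξ` is that Mellin transform at `δ + 2πiξ`. If `ζ` has no zero on `Re s = δ`,
Wiener's uniqueness theorem (`ae_eq_zero_of_correlation_eq_zero`) gives `f = 0`. Since the Fourier
transform is smooth, it can be divided into a test function, which keeps the proof elementary.
Conversely a zero `δ + iγ` makes `cos (γu)` a nonzero bounded solution
(`integral_logKernel_mul_cos_eq_zero`). The functional equation reduces RH to the lines `1/2 < δ <
1`. -/

section ZetaAndMellin

open MeasureTheory Set Complex Filter Topology Asymptotics HurwitzZeta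

/-! ### The Mellin transform of the Fermi function and `ζ`. -/

/-- The Fermi function `x ↦ (e^x + 1)⁻¹`. -/
noncomputable def fermi (x : ℝ) : ℝ := (Real.exp x + 1)⁻¹

lemma continuous_fermi : Continuous fermi := by
  unfold fermi
  exact Continuous.inv₀ (by fun_prop) fun x => by positivity

lemma fermi_nonneg (x : ℝ) : 0 ≤ fermi x := by unfold fermi; positivity

lemma fermi_le_exp_neg (x : ℝ) : fermi x ≤ Real.exp (-x) := by
  unfold fermi
  rw [Real.exp_neg]
  gcongr
  linarith

lemma mellinConvergent_and_differentiableAt_of_le_exp_neg {g : ℝ → ℝ} (hg : Continuous g)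
    (hle : ∀ x, |g x| ≤ Real.exp (-x)) {s : ℂ} (hs : 0 < s.re) :
    MellinConvergent (fun x => (g x : ℂ)) s ∧
      DifferentiableAt ℂ (mellin fun x => (g x : ℂ)) s := by
  have hloc : LocallyIntegrableOn (fun x => (g x : ℂ)) (Ioi 0) :=
    (by fun_prop : Continuous fun x => (g x : ℂ)).locallyIntegrable.locallyIntegrableOn _
  have htop : (fun x => (g x : ℂ)) =O[atTop] fun x => Real.exp (-1 * x) :=
    IsBigO.of_bound 1 (Eventually.of_forall fun x => by
      simpa [abs_of_pos (Real.exp_pos _)] using hle x)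
  have hbot : (fun x => (g x : ℂ)) =O[𝓝[>] 0] fun x : ℝ => x ^ (-(0 : ℝ)) := by
    refine IsBigO.of_bound 1 ?_
    filter_upwards [self_mem_nhdsWithin] with x (hx : 0 < x)
    simpa using (hle x).trans (Real.exp_le_one_iff.mpr (by linarith))
  exact ⟨mellinConvergent_of_isBigO_rpow_exp one_pos hloc htop hbot hs,
    mellin_differentiableAt_of_isBigO_rpow_exp one_pos hloc htop hbot hs⟩

/-- Away from the zero class of `ℝ/ℤ`, `cosZeta` is entire. -/
lemma coe_half_ne_zero : (((1 / 2 : ℝ) : ℝ) : UnitAddCircle) ≠ 0 := by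
  rw [Ne, AddCircle.coe_eq_zero_iff]
  rintro ⟨n, hn⟩
  have h2 : ((2 * n : ℤ) : ℝ) = 1 := by
    push_cast
    simp only [zsmul_eq_mul, mul_one] at hn
    linarith
  have : (2 * n : ℤ) = 1 := by exact_mod_cast h2
  omega

lemma cos_two_pi_half_mul (n : ℕ) : Real.cos (2 * Real.pi * (1 / 2 : ℝ) * n) = (-1) ^ n := by
  rw [show 2 * Real.pi * (1 / 2 : ℝ) * n = n * Real.pi by ring, Real.cos_nat_mul_pi]

lemma hasSum_cosZeta_half {s : ℂ} (hs : 1 < s.re) :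
    HasSum (fun n : ℕ => (-1 : ℂ) ^ n / (n : ℂ) ^ s) (cosZeta ((1 / 2 : ℝ) : UnitAddCircle) s) := by
  have := hasSum_nat_cosZeta (1 / 2) hs
  refine this.congr_fun fun n => ?_
  rw [cos_two_pi_half_mul]
  simp

/-- Adding the series of `ζ` to the alternating one cancels the odd terms and doubles the even ones,
leaving `2 · 2^(-s) ζ(s)`. -/
lemma cosZeta_half_of_one_lt_re {s : ℂ} (hs : 1 < s.re) :
    cosZeta ((1 / 2 : ℝ) : UnitAddCircle) s = (2 ^ (1 - s) - 1) * riemannZeta s := by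
  have hs0 : s ≠ 0 := by rintro rfl; simp at hs; linarith
  have hz : HasSum (fun n : ℕ => 1 / (n : ℂ) ^ s) (riemannZeta s) := by
    rw [zeta_eq_tsum_one_div_nat_cpow hs]
    exact (Complex.summable_one_div_nat_cpow.mpr hs).hasSum
  have h1 := (hasSum_cosZeta_half hs).add hz
  have h2 := hz.mul_left ((2 : ℂ) ^ (1 - s))
  have hinj : Function.Injective fun n : ℕ => 2 * n := fun a b h => by simpa using h
  have h3 : HasSum (fun n : ℕ => (-1 : ℂ) ^ n / (n : ℂ) ^ s + 1 / (n : ℂ) ^ s)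
      (2 ^ (1 - s) * riemannZeta s) := by
    rw [← hinj.hasSum_iff]
    · refine h2.congr_fun fun n => ?_
      have : ((2 * n : ℕ) : ℂ) ^ s = 2 ^ s * (n : ℂ) ^ s := by
        rw [Nat.cast_mul, natCast_mul_natCast_cpow]; simp
      simp only [Function.comp_apply, this, pow_mul, cpow_sub _ _ (two_ne_zero' ℂ), cpow_one]
      norm_num
      ring
    · intro n hn
      have : Odd n := by
        rw [← Nat.not_even_iff_odd]
        rintro ⟨k, rfl⟩
        exact hn ⟨k, by simp; ring⟩
      rw [this.neg_one_pow]
      ring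
  have := h1.unique h3
  linear_combination this

lemma cosZeta_half {s : ℂ} (hs : s ≠ 1) :
    cosZeta ((1 / 2 : ℝ) : UnitAddCircle) s = (2 ^ (1 - s) - 1) * riemannZeta s := by
  have ho : IsOpen ({1}ᶜ : Set ℂ) := isOpen_compl_singleton
  refine AnalyticOnNhd.eqOn_of_preconnected_of_eventuallyEq (𝕜 := ℂ) (U := {1}ᶜ) (z₀ := 2)
    (f := cosZeta ((1 / 2 : ℝ) : UnitAddCircle))
    (g := fun s => (2 ^ (1 - s) - 1) * riemannZeta s)
    (DifferentiableOn.analyticOnNhd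
      (differentiable_cosZeta_of_ne_zero coe_half_ne_zero).differentiableOn ho)
    (DifferentiableOn.analyticOnNhd (fun z hz => ?_) ho)
    (isConnected_compl_singleton_of_one_lt_rank (by simp) _).isPreconnected
    (by simp) ?_ hs
  · have := differentiableAt_riemannZeta hz
    refine DifferentiableAt.differentiableWithinAt (DifferentiableAt.mul ?_ this)
    exact (DifferentiableAt.const_cpow (by fun_prop) (Or.inl two_ne_zero)).sub_const _
  · have : {z : ℂ | 1 < z.re} ∈ 𝓝 (2 : ℂ) :=
      (isOpen_lt continuous_const continuous_re).mem_nhds (by simp)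
    filter_upwards [this] with z hz using cosZeta_half_of_one_lt_re hz

lemma hasSum_fermi {t : ℝ} (ht : 0 < t) :
    HasSum (fun n : ℕ => -(-1 : ℂ) ^ (n + 1) * Real.exp (-((n + 1 : ℕ) : ℝ) * t))
      (fermi t : ℂ) := by
  have hlt : |-Real.exp (-t)| < 1 := by
    rw [abs_neg, Real.abs_exp, Real.exp_lt_one_iff]; linarith
  have h := (hasSum_geometric_of_abs_lt_one hlt).mul_left (Real.exp (-t))
  have he : Real.exp (-t) * (1 - -Real.exp (-t))⁻¹ = fermi t := by
    unfold fermi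
    have := Real.exp_pos t
    have : Real.exp t + 1 ≠ 0 := by positivity
    rw [Real.exp_neg, sub_neg_eq_add, ← mul_inv]
    congr 1
    field_simp
  rw [he] at h
  refine (h.mapL (Complex.ofRealCLM : ℝ →L[ℝ] ℂ)).congr_fun fun n => ?_
  have : Real.exp (-((n + 1 : ℕ) : ℝ) * t) = Real.exp (-t) ^ n * Real.exp (-t) := by
    rw [← pow_succ, ← Real.exp_nat_mul]; congr 1; ring
  rw [this]
  simp only [Complex.ofRealCLM_apply, neg_pow (Real.exp (-t))]
  push_cast
  ring

lemma mellin_fermi_of_one_lt_re {s : ℂ} (hs : 1 < s.re) :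
    mellin (fun x => (fermi x : ℂ)) s =
      -Gamma s * cosZeta ((1 / 2 : ℝ) : UnitAddCircle) s := by
  have hs0 : s ≠ 0 := by rintro rfl; simp at hs; linarith
  have h := hasSum_mellin (a := fun n : ℕ => -(-1 : ℂ) ^ (n + 1))
    (p := fun n : ℕ => ((n + 1 : ℕ) : ℝ)) (F := fun x => (fermi x : ℂ)) (s := s)
    (fun i => Or.inr (by positivity)) (by linarith) (fun t ht => hasSum_fermi ht)
    (by
      have := (summable_nat_add_iff 1).mpr (Real.summable_one_div_nat_rpow.mpr hs)
      simpa using this)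
  -- The dropped term `n = 0` is zero because `0 ^ s = 0` and division by zero gives zero.
  have h2 := ((hasSum_nat_add_iff' 1).mpr (hasSum_cosZeta_half hs)).mul_left (-Gamma s)
  simp only [Finset.range_one, Finset.sum_singleton, Nat.cast_zero, zero_cpow hs0, div_zero,
    sub_zero] at h2
  refine (h.congr_fun fun n => ?_).unique h2
  simp
  ring

lemma mellin_fermi {s : ℂ} (hs : 0 < s.re) :
    mellin (fun x => (fermi x : ℂ)) s =
      -Gamma s * cosZeta ((1 / 2 : ℝ) : UnitAddCircle) s := by
  have ho : IsOpen {z : ℂ | 0 < z.re} := isOpen_lt continuous_const continuous_re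
  refine AnalyticOnNhd.eqOn_of_preconnected_of_eventuallyEq (𝕜 := ℂ) (U := {z : ℂ | 0 < z.re})
    (z₀ := 2) (f := mellin (fun x => (fermi x : ℂ)))
    (g := fun s => -Gamma s * cosZeta ((1 / 2 : ℝ) : UnitAddCircle) s)
    (DifferentiableOn.analyticOnNhd (fun z hz => ?_) ho)
    (DifferentiableOn.analyticOnNhd (fun z hz => ?_) ho)
    (convex_halfSpace_re_gt 0).isPreconnected
    (by simp) ?_ hs
  · exact (mellinConvergent_and_differentiableAt_of_le_exp_neg continuous_fermi (fun x => by
      rw [abs_of_nonneg (fermi_nonneg x)]; exact fermi_le_exp_neg x) hz).2.differentiableWithinAt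
  · refine DifferentiableAt.differentiableWithinAt (DifferentiableAt.mul
      (DifferentiableAt.neg (differentiableAt_Gamma _ fun m h => ?_))
      (differentiable_cosZeta_of_ne_zero coe_half_ne_zero z))
    have : z.re = -m := by rw [h]; simp
    have h0 : 0 < z.re := hz
    have : (0 : ℝ) ≤ m := m.cast_nonneg
    linarith
  · have : {z : ℂ | 1 < z.re} ∈ 𝓝 (2 : ℂ) :=
      (isOpen_lt continuous_const continuous_re).mem_nhds (by simp)
    filter_upwards [this] with z hz using mellin_fermi_of_one_lt_re hz

lemma mellin_exp_neg {s : ℂ} (hs : 0 < s.re) :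
    mellin (fun x => (Real.exp (-x) : ℂ)) s = Gamma s := by
  rw [Gamma_eq_integral hs, GammaIntegral_eq_mellin]

lemma mellin_fermi_eq_zero_iff {s : ℂ} (h0 : 0 < s.re) (h1 : s.re < 1) :
    mellin (fun x => (fermi x : ℂ)) s = 0 ↔ riemannZeta s = 0 := by
  have hs : s ≠ 1 := by rintro rfl; simp at h1
  -- The modulus of `2^(1-s)` is `2^(1 - Re s) > 1`.
  have h2 : (2 : ℂ) ^ (1 - s) - 1 ≠ 0 := by
    intro h
    have := congrArg norm (sub_eq_zero.mp h)
    rw [show (2 : ℂ) = ((2 : ℝ) : ℂ) by simp, norm_cpow_eq_rpow_re_of_pos two_pos] at this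
    have h3 := Real.one_lt_rpow (x := 2) (by norm_num) (show 0 < (1 - s).re by simpa using h1)
    simp at this h3
    linarith
  rw [mellin_fermi h0, cosZeta_half hs]
  simp [Gamma_ne_zero_of_re_pos h0, h2]

/-! ### Reduction of RH to the right half of the critical strip. -/

/-- By the functional equation it suffices to exclude zeros in the right half of the strip. -/
lemma riemannHypothesis_iff_right_half_strip :
    RiemannHypothesis ↔ ∀ s : ℂ, 1 / 2 < s.re → s.re < 1 → riemannZeta s ≠ 0 := by
  constructor
  · intro h s h1 h2 hz
    have := h s hz (by
      rintro ⟨n, rfl⟩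
      have : (0 : ℝ) ≤ n := n.cast_nonneg
      simp at h1
      linarith) (by rintro rfl; simp at h2)
    linarith
  · intro h s hz htriv hs1
    -- In the functional equation for `ζ(1 - w)`, the cosine is the only remaining factor that can
    -- vanish.
    have key : ∀ w : ℂ, (∀ n : ℕ, w ≠ -n) → w ≠ 1 → riemannZeta (1 - w) = 0 →
        riemannZeta w ≠ 0 → Complex.cos (Real.pi * w / 2) = 0 := by
      intro w hw hw1 h0 hne
      rw [riemannZeta_one_sub hw hw1] at h0
      have hG : Gamma w ≠ 0 := Gamma_ne_zero hw
      have hp : (2 * (Real.pi : ℂ)) ^ (-w) ≠ 0 := by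
        rw [Ne, cpow_eq_zero_iff]
        have := Real.pi_ne_zero
        simp [this]
      simpa [hne, hG, hp] using h0
    have hnn : ∀ w : ℂ, 0 < w.re → ∀ n : ℕ, w ≠ -n := by
      rintro w hw n rfl
      have : (0 : ℝ) ≤ n := n.cast_nonneg
      simp at hw
      linarith
    rcases le_or_gt 1 s.re with h1 | h1
    · exact absurd hz (riemannZeta_ne_zero_of_one_le_re h1)
    rcases le_or_gt s.re 0 with h0 | h0
    · exfalso
      have hre : 1 ≤ (1 - s).re := by simp; linarith
      have hs0 : s ≠ 0 := by
        rintro rfl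
        rw [riemannZeta_zero] at hz
        norm_num at hz
      have hc := key (1 - s) (hnn _ (by linarith)) (by simpa using hs0) (by simpa using hz)
        (riemannZeta_ne_zero_of_one_le_re hre)
      obtain ⟨k, hk⟩ := Complex.cos_eq_zero_iff.mp hc
      have hpi : (Real.pi : ℂ) ≠ 0 := by exact_mod_cast Real.pi_ne_zero
      have hsk : s = -2 * k := by
        field_simp at hk
        linear_combination -hk
      have hkre : s.re = -2 * (k : ℝ) := by rw [hsk]; simp
      -- `k = 0` would give `s = 0`, but `ζ(0) = -1/2`; the trivial zeros are `-2(n + 1)`.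
      have hk0 : (0 : ℤ) < k := by
        have h5 : (0 : ℝ) ≤ k := by linarith
        have h6 : (0 : ℤ) ≤ k := by exact_mod_cast h5
        refine lt_of_le_of_ne h6 ?_
        rintro rfl
        exact hs0 (by simpa using hsk)
      obtain ⟨n, rfl⟩ : ∃ n : ℕ, k = n + 1 := ⟨(k - 1).toNat, by omega⟩
      exact htriv ⟨n, by rw [hsk]; push_cast; ring⟩
    · by_contra hne
      rcases lt_or_gt_of_ne hne with hlt | hgt
      · refine h (1 - s) (by simp; linarith) (by simpa using h0) ?_
        rw [riemannZeta_one_sub (hnn s h0) hs1, hz, mul_zero]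
      · exact h s hgt h1 hz

/-! ### Mellin transforms of multiplicative convolutions. -/

/-- The multiplicative convolution of `G` with the weights `w 0, …, w (n - 1)`. -/
noncomputable def mulConvolution {n : ℕ} (G : ℝ → ℝ) (w : Fin n → ℝ → ℝ) (x : ℝ) : ℝ :=
  ∫ u in Set.univ.pi (fun _ : Fin n => Ioi (0 : ℝ)), G (x / ∏ j, u j) * ∏ j, (w j (u j) / u j)

lemma volume_restrict_pi_Ioi (n : ℕ) :
    (volume : Measure (Fin n → ℝ)).restrict (Set.univ.pi fun _ => Ioi (0 : ℝ)) =
      Measure.pi fun _ => (volume : Measure ℝ).restrict (Ioi 0) := by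
  rw [volume_pi, Measure.restrict_pi_pi]

lemma ae_pi_Ioi_pos (n : ℕ) :
    ∀ᵐ u ∂(Measure.pi fun _ : Fin n => (volume : Measure ℝ).restrict (Ioi 0)), ∀ j, 0 < u j := by
  rw [← volume_restrict_pi_Ioi]
  filter_upwards [ae_restrict_mem (MeasurableSet.univ_pi fun _ => measurableSet_Ioi)] with u hu j
  exact hu j (mem_univ j)

section DilatedProduct

variable {n : ℕ} {H : ℝ → ℂ} {W : Fin n → ℝ → ℂ}

lemma integral_Ioi_dilate {E : Type*} [NormedAddCommGroup E] [NormedSpace ℝ E] (g : ℝ → E) {P : ℝ}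
    (hP : 0 < P) : ∫ x in Ioi (0 : ℝ), g (x * P⁻¹) = P • ∫ x in Ioi (0 : ℝ), g x := by
  simp_rw [mul_comm _ P⁻¹]
  rw [integral_comp_mul_left_Ioi _ _ (inv_pos.mpr hP)]
  simp

/-- By Tonelli, integrating in `x` first: the dilation by `P = ∏ u j` produces a factor `P` that
cancels `P⁻¹`, leaving `‖H‖₁ ∏ ‖W j (u j)‖`. -/
lemma integrable_dilated_prod (hH : Measurable H) (hW : ∀ j, Measurable (W j))
    (hHi : IntegrableOn H (Ioi 0)) (hWi : ∀ j, IntegrableOn (W j) (Ioi 0)) :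
    Integrable (fun z : ℝ × (Fin n → ℝ) =>
        H (z.1 * (∏ j, z.2 j)⁻¹) * ((∏ j, z.2 j)⁻¹ : ℝ) * ∏ j, W j (z.2 j))
      ((volume.restrict (Ioi 0)).prod (Measure.pi fun _ => volume.restrict (Ioi 0))) := by
  have hm : Measurable (fun z : ℝ × (Fin n → ℝ) =>
        H (z.1 * (∏ j, z.2 j)⁻¹) * ((∏ j, z.2 j)⁻¹ : ℝ) * ∏ j, W j (z.2 j)) := by
    fun_prop
  rw [integrable_prod_iff' hm.aestronglyMeasurable]
  constructor
  · filter_upwards [ae_pi_Ioi_pos n] with u hu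
    have hP : 0 < (∏ j, u j)⁻¹ := inv_pos.mpr (Finset.prod_pos fun j _ => hu j)
    have : IntegrableOn (fun x => H (x * (∏ j, u j)⁻¹)) (Ioi 0) := by
      have := (integrableOn_Ioi_comp_mul_right_iff H 0 hP).mpr (by simpa using hHi)
      simpa using this
    exact (this.mul_const _).mul_const _
  · have hprod := (Integrable.fintype_prod (f := W) hWi).norm.const_mul
      (∫ x in Ioi (0 : ℝ), ‖H x‖)
    refine hprod.congr ?_
    filter_upwards [ae_pi_Ioi_pos n] with u hu
    have hP : 0 < ∏ j, u j := Finset.prod_pos fun j _ => hu j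
    simp only [norm_mul, integral_mul_const]
    rw [integral_Ioi_dilate (fun x => ‖H x‖) hP, norm_real, Real.norm_of_nonneg (by positivity),
      smul_eq_mul]
    field_simp

lemma integral_dilated_prod (hH : Measurable H) (hW : ∀ j, Measurable (W j))
    (hHi : IntegrableOn H (Ioi 0)) (hWi : ∀ j, IntegrableOn (W j) (Ioi 0)) :
    ∫ x in Ioi (0 : ℝ), ∫ u, H (x * (∏ j, u j)⁻¹) * ((∏ j, u j)⁻¹ : ℝ) * ∏ j, W j (u j)
        ∂(Measure.pi fun _ : Fin n => volume.restrict (Ioi (0 : ℝ))) =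
      (∫ x in Ioi (0 : ℝ), H x) * ∏ j, ∫ x in Ioi (0 : ℝ), W j x := by
  rw [integral_integral_swap (integrable_dilated_prod hH hW hHi hWi),
    ← integral_fintype_prod_eq_prod, ← integral_const_mul]
  refine integral_congr_ae ?_
  filter_upwards [ae_pi_Ioi_pos n] with u hu
  have hP : 0 < ∏ j, u j := Finset.prod_pos fun j _ => hu j
  simp only [integral_mul_const]
  rw [integral_Ioi_dilate H hP, real_smul]
  have : ((∏ j, u j : ℝ) : ℂ) ≠ 0 := by exact_mod_cast hP.ne'
  rw [ofReal_inv]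
  field_simp

end DilatedProduct

/-- Splitting `x^(s-1)` as `(x/P)^(s-1) ∏ u_j^(s-1)`, with `P = ∏ u_j`, distributes the Mellin
weight over the factors; `P⁻¹` comes from `∏ du_j / u_j`. -/
lemma cpow_mul_mulConvolution {n : ℕ} (G : ℝ → ℝ) (w : Fin n → ℝ → ℝ) (s : ℂ) {x : ℝ}
    (hx : 0 < x) :
    (x : ℂ) ^ (s - 1) * (mulConvolution G w x : ℂ) =
      ∫ u, (((x * (∏ j, u j)⁻¹ : ℝ) : ℂ) ^ (s - 1) * G (x * (∏ j, u j)⁻¹)) *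
          ((∏ j, u j)⁻¹ : ℝ) * ∏ j, (((u j : ℝ) : ℂ) ^ (s - 1) * w j (u j))
        ∂(Measure.pi fun _ : Fin n => volume.restrict (Ioi (0 : ℝ))) := by
  rw [mulConvolution, volume_restrict_pi_Ioi, ← integral_complex_ofReal, ← integral_const_mul]
  refine integral_congr_ae ?_
  filter_upwards [ae_pi_Ioi_pos n] with u hu
  have hP : 0 < ∏ j, u j := Finset.prod_pos fun j _ => hu j
  have h1 : ∏ j, ((u j : ℝ) : ℂ) ^ (s - 1) = ((∏ j, u j : ℝ) : ℂ) ^ (s - 1) := by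
    have : ∀ t : Finset (Fin n),
        ∏ j ∈ t, ((u j : ℝ) : ℂ) ^ (s - 1) = ((∏ j ∈ t, u j : ℝ) : ℂ) ^ (s - 1) := by
      intro t
      induction t using Finset.induction_on with
      | empty => simp
      | insert a t ha ih =>
        rw [Finset.prod_insert ha, Finset.prod_insert ha, ih, ofReal_mul,
          mul_cpow_ofReal_nonneg (hu a).le (Finset.prod_nonneg fun j _ => (hu j).le)]
    exact this Finset.univ
  have h2 : (x : ℂ) ^ (s - 1) = ((x * (∏ j, u j)⁻¹ : ℝ) : ℂ) ^ (s - 1) *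
      ((∏ j, u j : ℝ) : ℂ) ^ (s - 1) := by
    rw [← mul_cpow_ofReal_nonneg (by positivity) hP.le, ← ofReal_mul]
    congr 2
    field_simp
  rw [Finset.prod_mul_distrib, h1, h2, div_eq_mul_inv]
  simp only [Finset.prod_div_distrib]
  push_cast
  ring

lemma mellin_mulConvolution {n : ℕ} {G : ℝ → ℝ} {w : Fin n → ℝ → ℝ} {s : ℂ}
    (hG : Measurable G) (hw : ∀ j, Measurable (w j))
    (hGs : MellinConvergent (fun x => (G x : ℂ)) s)
    (hws : ∀ j, MellinConvergent (fun x => (w j x : ℂ)) s) :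
    MellinConvergent (fun x => (mulConvolution G w x : ℂ)) s ∧
      mellin (fun x => (mulConvolution G w x : ℂ)) s =
        mellin (fun x => (G x : ℂ)) s * ∏ j, mellin (fun x => (w j x : ℂ)) s := by
  have hH : Measurable fun x : ℝ => (x : ℂ) ^ (s - 1) * (G x : ℂ) := by fun_prop
  have hW : ∀ j, Measurable fun x : ℝ => (x : ℂ) ^ (s - 1) * (w j x : ℂ) := fun j => by
    have := hw j
    fun_prop
  constructor
  · refine (integrable_dilated_prod hH hW hGs hws).integral_prod_left.congr ?_
    filter_upwards [ae_restrict_mem measurableSet_Ioi] with x hx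
    exact (cpow_mul_mulConvolution G w s hx).symm
  · refine Eq.trans ?_ (integral_dilated_prod hH hW hGs hws)
    exact setIntegral_congr_fun measurableSet_Ioi fun x hx => cpow_mul_mulConvolution G w s hx

lemma diagKernel_eq_mulConvolution (k : ℕ) :
    diagKernel k = mulConvolution fermi fun _ : Fin k => fermi := rfl

lemma offDiagKernel_eq_mulConvolution (k m : ℕ) :
    offDiagKernel k m = mulConvolution (fun x => Real.exp (-x))
      fun j : Fin m => if j.val ≤ k then fermi else fun x => Real.exp (-x) := by
  ext x
  unfold offDiagKernel mulConvolution
  congr 1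
  ext u
  have h : ∏ j : Fin m, (if j.val ≤ k then fermi else fun x => Real.exp (-x)) (u j) =
      (∏ j with j.val ≤ k, (Real.exp (u j) + 1)⁻¹) * Real.exp (-∑ j with k < j.val, u j) := by
    rw [← Finset.sum_neg_distrib, Real.exp_sum,
      ← Finset.prod_filter_mul_prod_filter_not Finset.univ (fun j : Fin m => j.val ≤ k)]
    congr 1
    · exact Finset.prod_congr rfl fun j hj => by
        rw [if_pos (Finset.mem_filter.mp hj).2, fermi]
    · refine Finset.prod_congr (by simp) fun j hj => ?_
      rw [if_neg (Finset.mem_filter.mp hj).2.not_ge]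
  rw [Finset.prod_div_distrib, h]
  ring

lemma mellinConvergent_fermi {s : ℂ} (hs : 0 < s.re) :
    MellinConvergent (fun x => (fermi x : ℂ)) s :=
  (mellinConvergent_and_differentiableAt_of_le_exp_neg continuous_fermi (fun x => by
    rw [abs_of_nonneg (fermi_nonneg x)]; exact fermi_le_exp_neg x) hs).1

lemma differentiableAt_mellin_fermi {s : ℂ} (hs : 0 < s.re) :
    DifferentiableAt ℂ (mellin fun x => (fermi x : ℂ)) s :=
  (mellinConvergent_and_differentiableAt_of_le_exp_neg continuous_fermi (fun x => by
    rw [abs_of_nonneg (fermi_nonneg x)]; exact fermi_le_exp_neg x) hs).2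

lemma mellinConvergent_exp_neg {s : ℂ} (hs : 0 < s.re) :
    MellinConvergent (fun x => (Real.exp (-x) : ℂ)) s :=
  (mellinConvergent_and_differentiableAt_of_le_exp_neg (by fun_prop)
    (fun x => (abs_of_pos (Real.exp_pos _)).le) hs).1

/-- The Mellin transform of `U_{k,m}` is `(mellin fermi)^(k+1) Γ^(m-k)`. -/
lemma mellin_kernelU {k m : ℕ} (hkm : k ≤ m) {s : ℂ} (hs : 0 < s.re) :
    MellinConvergent (fun x => (kernelU k m x : ℂ)) s ∧
      mellin (fun x => (kernelU k m x : ℂ)) s =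
        mellin (fun x => (fermi x : ℂ)) s ^ (k + 1) * Gamma s ^ (m - k) := by
  have hF := mellinConvergent_fermi hs
  have hE := mellinConvergent_exp_neg hs
  have hEm : Measurable fun x : ℝ => Real.exp (-x) := by fun_prop
  rcases hkm.eq_or_lt with rfl | hlt
  · have h := mellin_mulConvolution (G := fermi) (w := fun _ : Fin k => fermi)
      continuous_fermi.measurable (fun _ => continuous_fermi.measurable) hF fun _ => hF
    simp only [kernelU, if_true, diagKernel_eq_mulConvolution]
    refine ⟨h.1, h.2.trans ?_⟩
    simp [pow_succ']
  · have h := mellin_mulConvolution (G := fun x => Real.exp (-x))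
      (w := fun j : Fin m => if j.val ≤ k then fermi else fun x => Real.exp (-x)) (s := s)
      hEm (fun j => by
        split_ifs
        exacts [continuous_fermi.measurable, hEm]) hE (fun j => by
        split_ifs
        exacts [hF, hE])
    simp only [kernelU, if_neg hlt.ne, offDiagKernel_eq_mulConvolution]
    refine ⟨h.1, h.2.trans ?_⟩
    have h3 : ∀ j : Fin m, mellin (fun x => (((if j.val ≤ k then fermi else
        fun x => Real.exp (-x)) x : ℝ) : ℂ)) s =
        if j.val ≤ k then mellin (fun x => (fermi x : ℂ)) s else Gamma s := fun j => by
      split_ifs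
      exacts [rfl, mellin_exp_neg hs]
    have hc : (Finset.univ.filter fun j : Fin m => j.val ≤ k).card = k + 1 := by
      have := Fin.card_Iic (⟨k, hlt⟩ : Fin m)
      rw [← this]
      congr 1
      ext j
      simp [Fin.le_def]
    have hc' : (Finset.univ.filter fun j : Fin m => ¬ j.val ≤ k).card = m - (k + 1) := by
      have := Finset.card_filter_add_card_filter_not (s := Finset.univ)
        (fun j : Fin m => j.val ≤ k)
      simp only [Finset.card_univ, Fintype.card_fin] at this
      omega
    rw [Finset.prod_congr rfl fun j _ => h3 j, Finset.prod_ite, Finset.prod_const,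
      Finset.prod_const, hc, hc', mellin_exp_neg hs, show m - k = m - (k + 1) + 1 by omega]
    ring

end ZetaAndMellin

open MeasureTheory Filter Topology Set
open scoped FourierTransform ContDiff

/-! ### Wiener's uniqueness theorem for smooth nonvanishing transforms. -/

section Wiener

lemma integrable_correlation {L ψ h : ℝ → ℂ} (hL : Integrable L) (hψ : Integrable ψ)
    (hm : AEStronglyMeasurable h) {C : ℝ} (hC : ∀ u, ‖h u‖ ≤ C) :
    Integrable (fun p : ℝ × ℝ => ψ p.2 * L (p.1 - p.2) * h p.1) (volume.prod volume) := by
  have := hψ.convolution_integrand (ContinuousLinearMap.mul ℂ ℂ) hL (μ := volume)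
  exact this.mul_bdd (hm.comp_quasiMeasurePreserving Measure.quasiMeasurePreserving_fst)
    (Eventually.of_forall fun p => hC p.1)

lemma integral_correlation_swap {L ψ h : ℝ → ℂ} (hL : Integrable L) (hψ : Integrable ψ)
    (hm : AEStronglyMeasurable h) {C : ℝ} (hC : ∀ u, ‖h u‖ ≤ C) :
    ∫ u, (∫ y, ψ y * L (u - y)) * h u = ∫ y, ψ y * ∫ u, L (u - y) * h u := by
  simp_rw [← integral_mul_const]
  rw [integral_integral_swap (integrable_correlation hL hψ hm hC)]
  simp_rw [mul_assoc, integral_const_mul]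

lemma integral_mul_fourier_eq {f g : ℝ → ℂ} (hf : Integrable f) (hg : Integrable g) :
    ∫ x, 𝓕 f x * g x = ∫ x, f x * 𝓕 g x := by
  simpa using! (VectorFourier.integral_fourierIntegral_smul_eq_flip (L := innerₗ ℝ)
    Real.continuous_fourierChar continuous_inner hf hg)

lemma fourierInv_sub_eq_fourier (p : ℝ → ℂ) (u y : ℝ) :
    𝓕⁻ p (u - y) = 𝓕 (fun v : ℝ => Complex.exp (2 * Real.pi * (v * u) * Complex.I) * p v) y := by
  rw [Real.fourierInv_eq', Real.fourier_real_eq_integral_exp_smul]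
  refine integral_congr_ae (Eventually.of_forall fun v => ?_)
  simp only [smul_eq_mul, ← mul_assoc, ← Complex.exp_add]
  congr 2
  simp
  ring

/-- The modulation of `p` encodes the translation by `u`, so the multiplication formula moves the
transform onto `L`; no inversion of `𝓕 L` is needed. -/
lemma integral_fourierInv_mul_fourier {L p : ℝ → ℂ} (hL : Integrable L) (hp : Integrable p)
    (u : ℝ) : ∫ y, 𝓕⁻ p y * L (u - y) = 𝓕⁻ (fun v => 𝓕 L v * p v) u := by
  have hq : Integrable fun v : ℝ => Complex.exp (2 * Real.pi * (v * u) * Complex.I) * p v := by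
    refine hp.bdd_mul (c := 1) (by fun_prop) (Eventually.of_forall fun v => ?_)
    rw [show (2 * Real.pi * (v * u) * Complex.I : ℂ) = ((2 * Real.pi * (v * u) : ℝ) : ℂ) *
      Complex.I by push_cast; ring, Complex.norm_exp_ofReal_mul_I]
  rw [← integral_sub_left_eq_self _ volume u]
  simp only [sub_sub_cancel, fourierInv_sub_eq_fourier]
  simp_rw [mul_comm _ (L _)]
  rw [← integral_mul_fourier_eq hL hq, Real.fourierInv_eq']
  refine integral_congr_ae (Eventually.of_forall fun v => ?_)
  simp only [smul_eq_mul]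
  rw [show ((2 * Real.pi * inner ℝ v u : ℝ) : ℂ) = 2 * Real.pi * (v * u) by simp; ring]
  ring

lemma integrable_fourierInv_of_hasCompactSupport {χ : ℝ → ℂ} (hχ : ContDiff ℝ ∞ χ)
    (hc : HasCompactSupport χ) : Integrable (𝓕⁻ χ) := by
  have := (𝓕⁻ (hc.toSchwartzMap hχ)).integrable (μ := volume)
  rwa [SchwartzMap.fourierInv_coe] at this

/-- The spectrum of a bounded solution of the convolution equation avoids the set where the Fourier
transform of the kernel does not vanish. -/
lemma integral_fourierInv_mul_eq_zero {L h χ : ℝ → ℂ} (hL : Integrable L)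
    (hsm : ContDiff ℝ ∞ (𝓕 L)) (hne : ∀ ξ, 𝓕 L ξ ≠ 0) (hm : AEStronglyMeasurable h) {C : ℝ}
    (hC : ∀ u, ‖h u‖ ≤ C) (hz : ∀ x, ∫ u, L (u - x) * h u = 0) (hχ : ContDiff ℝ ∞ χ)
    (hc : HasCompactSupport χ) : ∫ u, 𝓕⁻ χ u * h u = 0 := by
  -- Smoothness of `𝓕 L` makes the quotient a test function, so its inverse transform is integrable
  -- and convolves with `L` to `𝓕⁻ χ`.
  have hp : ContDiff ℝ ∞ fun v => χ v * (𝓕 L v)⁻¹ := hχ.mul (hsm.inv hne)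
  have hpc : HasCompactSupport fun v => χ v * (𝓕 L v)⁻¹ := hc.mul_right
  have hpi : Integrable fun v => χ v * (𝓕 L v)⁻¹ := hp.continuous.integrable_of_hasCompactSupport hpc
  have hψ := integrable_fourierInv_of_hasCompactSupport hp hpc
  have hswap := integral_correlation_swap hL hψ hm hC
  have hχ' : (fun v => 𝓕 L v * (χ v * (𝓕 L v)⁻¹)) = χ := by
    ext v
    have := hne v
    field_simp
  simp_rw [hz, mul_zero, integral_zero, integral_fourierInv_mul_fourier hL hpi, hχ'] at hswap
  exact hswap

lemma fourierInv_comp_mul (χ : ℝ → ℂ) {ε : ℝ} (hε : 0 < ε) (u : ℝ) :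
    𝓕⁻ (fun v => χ (ε * v)) u = (ε⁻¹ : ℝ) • 𝓕⁻ χ (u / ε) := by
  rw [Real.fourierInv_eq', Real.fourierInv_eq']
  have := Measure.integral_comp_mul_left (fun v : ℝ =>
    Complex.exp ((2 * Real.pi * inner ℝ v (u / ε) : ℝ) * Complex.I) • χ v) ε
  rw [abs_of_pos (inv_pos.mpr hε)] at this
  rw [← this]
  congr 1
  ext v
  congr 4
  simp
  field_simp

/-- Dilating `χ` turns `𝓕⁻ χ` into an approximate identity of mass `χ 0 = 1`. Its integrals against
`h` all vanish, yet they tend to `h 0`. -/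
lemma continuous_solution_apply_zero {L h : ℝ → ℂ} (hL : Integrable L)
    (hsm : ContDiff ℝ ∞ (𝓕 L)) (hne : ∀ ξ, 𝓕 L ξ ≠ 0) (hh : Continuous h) {C : ℝ}
    (hC : ∀ u, ‖h u‖ ≤ C) (hz : ∀ x, ∫ u, L (u - x) * h u = 0) : h 0 = 0 := by
  let b : ContDiffBump (0 : ℝ) := ⟨1, 2, one_pos, one_lt_two⟩
  let χ : ℝ → ℂ := fun v => (b v : ℂ)
  have hχ : ContDiff ℝ ∞ χ := Complex.ofRealCLM.contDiff.comp b.contDiff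
  have hc : HasCompactSupport χ := b.hasCompactSupport.comp_left (g := fun x : ℝ => (x : ℂ)) rfl
  have hχ0 : χ 0 = 1 := by
    have : b 0 = 1 := b.one_of_mem_closedBall (by simp [b])
    simp [χ, this]
  have hφ := integrable_fourierInv_of_hasCompactSupport hχ hc
  have hscale : ∀ ε : ℝ, 0 < ε → ∫ v, 𝓕⁻ χ v * h (ε * v) = 0 := by
    intro ε hε
    have hc' : HasCompactSupport fun v => χ (ε * v) :=
      hc.comp_homeomorph (Homeomorph.mulLeft₀ ε hε.ne')
    have hχ' : ContDiff ℝ ∞ fun v => χ (ε * v) := hχ.comp (contDiff_const.mul contDiff_id)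
    have h1 := integral_fourierInv_mul_eq_zero hL hsm hne hh.aestronglyMeasurable hC hz hχ' hc'
    have h2 := Measure.integral_comp_mul_left (fun u => 𝓕⁻ (fun v => χ (ε * v)) u * h u) ε
    rw [h1, smul_zero] at h2
    simp only [fourierInv_comp_mul χ hε, mul_div_cancel_left₀ _ hε.ne', smul_mul_assoc,
      integral_smul] at h2
    exact (smul_eq_zero.mp h2).resolve_left (inv_pos.mpr hε).ne'
  have hlim : Tendsto (fun n : ℕ => ∫ v, 𝓕⁻ χ v * h ((1 / ((n : ℝ) + 1)) * v)) atTop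
      (𝓝 (∫ v, 𝓕⁻ χ v * h 0)) := by
    refine tendsto_integral_of_dominated_convergence (fun v => ‖𝓕⁻ χ v‖ * C)
      (fun n => hφ.aestronglyMeasurable.mul
        (hh.comp (continuous_const_mul _)).aestronglyMeasurable)
      (hφ.norm.mul_const C) (fun n => Eventually.of_forall fun v => ?_)
      (Eventually.of_forall fun v => ?_)
    · rw [norm_mul]
      gcongr
      exact hC _
    · refine Tendsto.const_mul _ ((hh.tendsto 0).comp ?_)
      simpa using tendsto_one_div_add_atTop_nhds_zero_nat.mul_const v
  have h0 : ∫ v, 𝓕⁻ χ v * h 0 = 0 := by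
    refine tendsto_nhds_unique hlim ?_
    simp_rw [hscale _ Nat.one_div_pos_of_nat]
    exact tendsto_const_nhds
  have hint : ∫ v, 𝓕⁻ χ v = 1 := by
    have hinv : 𝓕 (𝓕⁻ χ) = χ := by
      have : 𝓕 (𝓕⁻ (hc.toSchwartzMap hχ)) = hc.toSchwartzMap hχ :=
        FourierTransform.fourier_fourierInv_eq _
      have h3 := congrArg (fun f : SchwartzMap ℝ ℂ => (f : ℝ → ℂ)) this
      simp only [SchwartzMap.fourier_coe, SchwartzMap.fourierInv_coe] at h3
      exact h3
    have h4 := congrFun hinv 0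
    rw [hχ0, Real.fourier_real_eq] at h4
    simpa using h4
  rw [integral_mul_const, hint, one_mul] at h0
  exact h0

/-- Wiener's uniqueness theorem for integrable kernels whose Fourier transform is smooth and has no
zero. -/
theorem ae_eq_zero_of_correlation_eq_zero {L f : ℝ → ℂ} (hL : Integrable L)
    (hsm : ContDiff ℝ ∞ (𝓕 L)) (hne : ∀ ξ, 𝓕 L ξ ≠ 0) (hm : AEStronglyMeasurable f) {C : ℝ}
    (hC : ∀ u, ‖f u‖ ≤ C) (hz : ∀ x, ∫ u, L (u - x) * f u = 0) : ∀ᵐ u, f u = 0 := by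
  have hloc : LocallyIntegrable f := by
    refine (locallyIntegrable_const C).mono hm (Eventually.of_forall fun u => ?_)
    exact (hC u).trans (le_abs_self C)
  refine ae_eq_zero_of_integral_contDiff_smul_eq_zero hloc fun g hg hgc => ?_
  have hgi : Integrable g := hg.continuous.integrable_of_hasCompactSupport hgc
  -- Smoothing `f` by `g` gives a bounded continuous solution of the same equation; its value at `0`
  -- is the required pairing of `g` with `f`.
  let h : ℝ → ℂ := fun t => ∫ y, (g (y - t) : ℂ) * f y
  have hgC : ContDiff ℝ ∞ fun x => (g x : ℂ) := Complex.ofRealCLM.contDiff.comp hg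
  have hh : Continuous h := by
    have hsupp : HasCompactSupport fun x : ℝ => (g (-x) : ℂ) :=
      (hgc.comp_left (g := fun x : ℝ => (x : ℂ)) rfl).comp_homeomorph (Homeomorph.neg ℝ)
    have := hsupp.continuous_convolution_right (μ := volume) (ContinuousLinearMap.mul ℂ ℂ) hloc
      (hgC.continuous.comp continuous_neg)
    refine this.congr fun t => ?_
    simp only [h, MeasureTheory.convolution, ContinuousLinearMap.mul_apply', neg_sub,
      mul_comm (f _)]
  have hshift : ∀ t, h t = ∫ y, (g y : ℂ) * f (y + t) := fun t => by
    simp only [h]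
    rw [← integral_add_right_eq_self _ t]
    simp
  have hb : ∀ t, ‖h t‖ ≤ (∫ y, ‖g y‖) * C := fun t => by
    rw [hshift, ← integral_mul_const]
    refine norm_integral_le_of_norm_le (hgi.norm.mul_const C) (Eventually.of_forall fun y => ?_)
    rw [norm_mul, Complex.norm_real]
    gcongr
    exact hC _
  have hzero : ∀ x, ∫ t, L (t - x) * h t = 0 := by
    intro x
    have hLx : Integrable fun t => L (t - x) := hL.comp_sub_right x
    have hgi' : Integrable fun y => (g y : ℂ) := hgi.ofReal
    simp only [h]
    rw [← integral_correlation_swap hgi' hLx hm hC]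
    have hcomm : ∀ u, ∫ t, L (t - x) * (g (u - t) : ℂ) = ∫ y, (g y : ℂ) * L (u - y - x) :=
      fun u => by
        rw [← integral_sub_left_eq_self _ volume u]
        simp only [sub_sub_cancel, mul_comm]
    simp_rw [hcomm]
    rw [integral_correlation_swap hLx hgi' hm hC]
    simp_rw [sub_sub, hz, mul_zero, integral_zero]
  have := continuous_solution_apply_zero hL hsm hne hh hb hzero
  simpa [h] using this

end Wiener

/-! ### The convolution kernel in logarithmic variables. -/

lemma MellinConvergent.integrable_exp_smul {f : ℝ → ℂ} {σ : ℝ} (hf : MellinConvergent f σ) :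
    Integrable fun u : ℝ => Real.exp (-σ * u) • f (Real.exp (-u)) := by
  have himage : (fun u : ℝ => Real.exp (-u)) '' univ = Ioi 0 := by
    rw [image_univ, ← Real.range_exp]
    exact neg_surjective.range_comp Real.exp
  have hderiv : ∀ u ∈ univ, HasDerivWithinAt (fun u : ℝ => Real.exp (-u)) (-Real.exp (-u)) univ u :=
    fun u _ => HasDerivAt.hasDerivWithinAt (by simpa using (hasDerivAt_neg u).exp)
  have hinj : InjOn (fun u : ℝ => Real.exp (-u)) univ :=
    (Real.exp_injective.comp neg_injective).injOn
  rw [MellinConvergent, ← himage,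
    integrableOn_image_iff_integrableOn_abs_deriv_smul MeasurableSet.univ hderiv hinj,
    integrableOn_univ] at hf
  refine hf.congr (Eventually.of_forall fun u => ?_)
  simp only [abs_neg, Real.abs_exp]
  rw [← Complex.ofReal_one, ← Complex.ofReal_sub, ← Complex.ofReal_cpow (Real.exp_pos _).le,
    Complex.coe_smul, smul_smul, ← Real.exp_mul, ← Real.exp_add]
  congr 2
  ring

/-- The kernel `u ↦ e^{-δu} U_{k,m}(e^{-u})` of the convolution equation on `ℝ`. -/
noncomputable def logKernel (k m : ℕ) (δ u : ℝ) : ℝ :=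
  Real.exp (-δ * u) * kernelU k m (Real.exp (-u))

lemma exp_mul_kernelU_eq (k m : ℕ) (δ x u : ℝ) :
    Real.exp (-δ * u) * kernelU k m (Real.exp (x - u)) =
      Real.exp (-δ * x) * logKernel k m δ (u - x) := by
  rw [logKernel, ← mul_assoc, ← Real.exp_add, neg_sub]
  congr 2
  ring

section LogKernel

variable {k m : ℕ} {δ : ℝ}

lemma integrable_ofReal_logKernel (hkm : k ≤ m) (hδ : 0 < δ) :
    Integrable fun u => (logKernel k m δ u : ℂ) := by
  have := (mellin_kernelU hkm (s := (δ : ℂ)) (by simpa using hδ)).1.integrable_exp_smul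
  refine this.congr (Eventually.of_forall fun u => ?_)
  simp [logKernel]

lemma integrable_logKernel (hkm : k ≤ m) (hδ : 0 < δ) : Integrable (logKernel k m δ) := by
  simpa using (integrable_ofReal_logKernel hkm hδ).re

lemma fourier_logKernel (ξ : ℝ) :
    𝓕 (fun u => (logKernel k m δ u : ℂ)) ξ =
      mellin (fun x => (kernelU k m x : ℂ)) (δ + (2 * Real.pi * ξ : ℝ) * Complex.I) := by
  rw [mellin_eq_fourier]
  have : (2 * Real.pi * ξ) / (2 * Real.pi) = ξ := by
    have := Real.pi_ne_zero
    field_simp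
  simp [logKernel, this]

lemma fourier_logKernel_eq (hkm : k ≤ m) (hδ : 0 < δ) :
    𝓕 (fun u => (logKernel k m δ u : ℂ)) = fun ξ : ℝ =>
      mellin (fun x => (fermi x : ℂ)) (δ + (2 * Real.pi * ξ : ℝ) * Complex.I) ^ (k + 1) *
        Complex.Gamma (δ + (2 * Real.pi * ξ : ℝ) * Complex.I) ^ (m - k) := by
  ext ξ
  rw [fourier_logKernel, (mellin_kernelU hkm (by simpa using hδ)).2]

lemma contDiff_fourier_logKernel (hkm : k ≤ m) (hδ : 0 < δ) :
    ContDiff ℝ ∞ (𝓕 fun u => (logKernel k m δ u : ℂ)) := by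
  rw [fourier_logKernel_eq hkm hδ]
  have ho : IsOpen {z : ℂ | 0 < z.re} := isOpen_lt continuous_const Complex.continuous_re
  have hd : DifferentiableOn ℂ (fun s => mellin (fun x => (fermi x : ℂ)) s ^ (k + 1) *
      Complex.Gamma s ^ (m - k)) {z : ℂ | 0 < z.re} := fun z hz => by
    have hG : DifferentiableAt ℂ Complex.Gamma z :=
      Complex.differentiableAt_Gamma z fun n h => by
        have h0 : 0 < z.re := hz
        have : (0 : ℝ) ≤ n := n.cast_nonneg
        rw [h] at h0
        simp at h0
        linarith
    exact (((differentiableAt_mellin_fermi hz).pow _).mul (hG.pow _)).differentiableWithinAt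
  have hc : ContDiffOn ℝ ∞ (fun s => mellin (fun x => (fermi x : ℂ)) s ^ (k + 1) *
      Complex.Gamma s ^ (m - k)) {z : ℂ | 0 < z.re} :=
    (hd.contDiffOn ho).restrict_scalars ℝ
  have hline : ContDiff ℝ ∞ fun ξ : ℝ => (δ : ℂ) + (2 * Real.pi * ξ : ℝ) * Complex.I :=
    contDiff_const.add ((Complex.ofRealCLM.contDiff.comp
      (contDiff_const.mul contDiff_id)).mul contDiff_const)
  exact hc.comp_contDiff hline fun ξ => by simpa using hδ

lemma fourier_logKernel_eq_zero_iff (hkm : k ≤ m) (h0 : 0 < δ) (h1 : δ < 1) (ξ : ℝ) :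
    𝓕 (fun u => (logKernel k m δ u : ℂ)) ξ = 0 ↔
      riemannZeta (δ + (2 * Real.pi * ξ : ℝ) * Complex.I) = 0 := by
  have hG : Complex.Gamma (δ + (2 * Real.pi * ξ : ℝ) * Complex.I) ≠ 0 :=
    Complex.Gamma_ne_zero_of_re_pos (by simpa using h0)
  rw [fourier_logKernel_eq hkm h0]
  simp only [mul_eq_zero, pow_eq_zero_iff (Nat.succ_ne_zero k), pow_ne_zero _ hG, or_false]
  exact mellin_fermi_eq_zero_iff (by simpa using h0) (by simpa using h1)

lemma real_ae_eq_zero_of_integral_logKernel_eq_zero (hkm : k ≤ m) (h0 : 0 < δ) (h1 : δ < 1)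
    (hζ : ∀ s : ℂ, s.re = δ → riemannZeta s ≠ 0) {g : ℝ → ℝ} (hm : AEStronglyMeasurable g) {C : ℝ}
    (hC : ∀ u, ‖g u‖ ≤ C) (hz : ∀ x, ∫ u, logKernel k m δ (u - x) * g u = 0) :
    ∀ᵐ u, g u = 0 := by
  have := ae_eq_zero_of_correlation_eq_zero (f := fun u => (g u : ℂ)) (C := C)
    (integrable_ofReal_logKernel hkm h0) (contDiff_fourier_logKernel hkm h0)
    (fun ξ h => hζ _ (by simp) ((fourier_logKernel_eq_zero_iff hkm h0 h1 ξ).mp h))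
    (Complex.continuous_ofReal.comp_aestronglyMeasurable hm) (fun u => by simpa using hC u)
    (fun x => by
      have := congrArg (fun r : ℝ => (r : ℂ)) (hz x)
      simp only [← integral_complex_ofReal] at this
      simpa using this)
  filter_upwards [this] with u hu
  simpa using hu

/-- The Fourier transform vanishes at `s.im / (2π)`, so a pure exponential solves the equation; as
the kernel is real, so does its real part, which serves both scalar fields. -/
lemma integral_logKernel_mul_cos_eq_zero (hkm : k ≤ m) {s : ℂ} (h0 : 0 < s.re) (h1 : s.re < 1)
    (hs : riemannZeta s = 0) (x : ℝ) :
    ∫ u, logKernel k m s.re (u - x) * Real.cos (s.im * u) = 0 := by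
  have hF : 𝓕 (fun u => (logKernel k m s.re u : ℂ)) (s.im / (2 * Real.pi)) = 0 := by
    rw [fourier_logKernel_eq_zero_iff hkm h0 h1, mul_div_cancel₀ _ (by positivity),
      Complex.re_add_im, hs]
  rw [Real.fourier_real_eq_integral_exp_smul, ← integral_sub_right_eq_self _ x] at hF
  have hint : Integrable fun u : ℝ => Complex.exp (((-s.im * u : ℝ) : ℂ) * Complex.I) *
      (logKernel k m s.re (u - x) : ℂ) :=
    ((integrable_ofReal_logKernel hkm h0).comp_sub_right x).bdd_mul (c := 1) (by fun_prop)
      (Eventually.of_forall fun u => (Complex.norm_exp_ofReal_mul_I _).le)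
  have hI : ∫ u : ℝ, Complex.exp (((-s.im * u : ℝ) : ℂ) * Complex.I) *
      (logKernel k m s.re (u - x) : ℂ) = 0 := by
    have h2 : ∀ u : ℝ, Complex.exp (((-s.im * u : ℝ) : ℂ) * Complex.I) *
        (logKernel k m s.re (u - x) : ℂ) = Complex.exp (((-s.im * x : ℝ) : ℂ) * Complex.I) *
        (Complex.exp ((-2 * Real.pi * (u - x) * (s.im / (2 * Real.pi)) : ℝ) * Complex.I) •
          (logKernel k m s.re (u - x) : ℂ)) := fun u => by
      rw [smul_eq_mul, ← mul_assoc, ← Complex.exp_add, ← add_mul, ← Complex.ofReal_add]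
      congr 4
      have := Real.pi_ne_zero
      field_simp
      ring
    simp_rw [h2]
    rw [integral_const_mul, hF, mul_zero]
  have h3 := congrArg Complex.re hI
  have h4 := integral_re hint
  simp only [RCLike.re_to_complex] at h4
  rw [← h4] at h3
  rw [← Complex.zero_re, ← h3]
  congr 1
  ext u
  rw [Complex.re_mul_ofReal, Complex.exp_ofReal_mul_I_re, neg_mul, Real.cos_neg, mul_comm]

lemma integral_exp_mul_kernelU_smul {𝕜 : Type*} [RCLike 𝕜] (k m : ℕ) (δ x : ℝ) (f : ℝ → 𝕜) :
    ∫ u : ℝ, (Real.exp (-δ * u) * kernelU k m (Real.exp (x - u))) • f u =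
      Real.exp (-δ * x) • ∫ u : ℝ, logKernel k m δ (u - x) • f u := by
  rw [← integral_smul]
  simp_rw [exp_mul_kernelU_eq, smul_smul]

end LogKernel

/-! ### The equivalence over real or complex scalars. -/

theorem theorem9 {𝕜 : Type*} [RCLike 𝕜] (k m : ℕ) (hkm : k ≤ m) :
    RiemannHypothesis ↔
      ∀ δ : ℝ, 1 / 2 < δ → δ < 1 →
        ∀ f : ℝ → 𝕜, AEMeasurable f MeasureTheory.volume → (∃ C : ℝ, ∀ u : ℝ, ‖f u‖ ≤ C) →
          (∀ x : ℝ,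
            ∫ u : ℝ, (Real.exp (-δ * u) * kernelU k m (Real.exp (x - u))) • f u = 0) →
          ∀ᵐ u : ℝ, f u = 0 := by
  rw [riemannHypothesis_iff_right_half_strip]
  simp_rw [integral_exp_mul_kernelU_smul, smul_eq_zero, (Real.exp_pos _).ne', false_or]
  constructor
  · rintro hζ δ hδ hδ1 f hf ⟨C, hC⟩ hz
    have h0 : 0 < δ := by linarith
    have hfs := hf.aestronglyMeasurable
    have hint : ∀ x, Integrable fun u => logKernel k m δ (u - x) • f u := fun x =>
      ((integrable_logKernel hkm h0).comp_sub_right x).smul_bdd C hfs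
        (Eventually.of_forall hC)
    have hline : ∀ s : ℂ, s.re = δ → riemannZeta s ≠ 0 := fun s hs =>
      hζ s (hs ▸ hδ) (hs ▸ hδ1)
    -- The kernel is real, so the real and imaginary parts of `f` solve the equation separately.
    have hre := real_ae_eq_zero_of_integral_logKernel_eq_zero hkm h0 hδ1 hline
      (g := fun u => RCLike.re (f u)) (C := C) (RCLike.continuous_re.comp_aestronglyMeasurable hfs)
      (fun u => (RCLike.norm_re_le_norm _).trans (hC u)) fun x => by
        have := integral_re (hint x)
        rw [hz x] at this
        simpa [RCLike.smul_re] using this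
    have him := real_ae_eq_zero_of_integral_logKernel_eq_zero hkm h0 hδ1 hline
      (g := fun u => RCLike.im (f u)) (C := C) (RCLike.continuous_im.comp_aestronglyMeasurable hfs)
      (fun u => (RCLike.norm_im_le_norm _).trans (hC u)) fun x => by
        have := integral_im (hint x)
        rw [hz x] at this
        simpa [RCLike.smul_im] using this
    filter_upwards [hre, him] with u h1 h2
    exact RCLike.ext (by simpa using h1) (by simpa using h2)
  · intro h s hs hs1 hzero
    have hcos : Continuous fun u : ℝ => Real.cos (s.im * u) := by fun_prop
    have hfc : Continuous fun u : ℝ => ((Real.cos (s.im * u) : ℝ) : 𝕜) :=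
      RCLike.continuous_ofReal.comp hcos
    have hae := h s.re hs hs1 (fun u => ((Real.cos (s.im * u) : ℝ) : 𝕜))
      hfc.measurable.aemeasurable
      ⟨1, fun u => by simpa using Real.abs_cos_le_one _⟩ fun x => by
        have := integral_logKernel_mul_cos_eq_zero hkm (by linarith) hs1 hzero x
        have h2 := congrArg (fun r : ℝ => (r : 𝕜)) this
        simp only [← integral_ofReal] at h2
        simpa [RCLike.real_smul_eq_coe_mul] using h2
    -- By continuity the cosine would vanish everywhere, but it is `1` at `0`.
    have heq := (hfc.ae_eq_iff_eq volume continuous_const).mp hae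
    have := congrFun heq 0
    simp at this
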